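/- Let $p$ be a prime number. An element of a finite group is called $p$-regular if its order is prime to $p$. For $k\ge 0$ let $R_k$ be the complex vector space of class functions $GL_k(\mathbb F_p)\to\mathbb C$ that vanish outside the $p$-regular elements. (Brauer characters identify $R_k$ with $\mathbb C\otimes K_0(\mathbb F_pGL_k(\mathbb F_p)\text{-proj})$.) Equip the graded space $R=\bigoplus_{k\ge 0}R_k$ with the induction product: for $\rho\in R_k$, $\sigma\in R_l$ and $g\in GL_{k+l}(\mathbb F_p)$, $$(\rho\cdot\sigma)(g)=\frac{1}{|GL_k(\mathbb F_p)|\,|GL_l(\mathbb F_p)|}\sum_{\substack{h\in GL_{k+l}(\mathbb F_p)\\ hgh^{-1}=\left(\begin{smallmatrix}a&0\\0&b\end{smallmatrix}\right)}}\rho(a)\,\sigma(b),$$ where the sum runs over the $h$ for which $hgh^{-1}$ is block diagonal with blocks $a\in GL_k(\mathbb F_p)$ and $b\in GL_l(\mathbb F_p)$. This makes $R$ an associative ring, whose unit is the constant function $1\in R_0$. For a polynomial $f\in\mathbb F_p[x]$ of degree $k$, let $\pi_f\in R_k$ be the function that is $1$ on the $p$-regular elements with characteristic polynomial $f$ and $0$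 elsewhere. For $m\ge 0$ put $\psi_m(q)=\prod_{i=1}^m(q^i-1)$. Let $f\in\mathbb F_p[x]$ be a monic irreducible polynomial of degree $d$ with non-zero constant coefficient. Then, for every integer $n\ge 0$, in the ring $R$, $$(\pi_f)^n=p^{d\binom n2}\,\frac{\psi_n(p^d)}{\psi_1(p^d)^n}\,\pi_{f^n}.$$ -/

import Mathlib

open Polynomial

namespace GLInduction

noncomputable section

/-! ### Induction of complex functions along a homomorphism of finite groups -/

/-- The induction formula: the value at `g` is `1 / |H|` times the sum of the numbers `φ h` over
all `x : G` and `h : H` with `x * g * x⁻¹ = i h`. -/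
def ind {H G : Type} [Group H] [Group G] [Fintype H] [Fintype G]
    (i : H →* G) (φ : H → ℂ) (g : G) : ℂ :=
  open Classical in
  (1 / (Fintype.card H : ℂ)) * ∑ x : G, ∑ h : H, if x * g * x⁻¹ = i h then φ h else 0

theorem ind_conj {H G : Type} [Group H] [Group G] [Fintype H] [Fintype G]
    (i : H →* G) (φ : H → ℂ) (y g : G) : ind i φ (y * g * y⁻¹) = ind i φ g := by
  classical
  unfold ind
  congr 1
  refine Fintype.sum_equiv (Equiv.mulRight y) _ _ fun x => ?_
  simp [mul_assoc]

theorem ind_comp {K H G : Type} [Group K] [Group H] [Group G] [Fintype K] [Fintype H] [Fintype G]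
    (i : H →* G) (j : K →* H) (φ : K → ℂ) : ind i (ind j φ) = ind (i.comp j) φ := by
  classical
  funext g
  unfold ind
  have hH : (Fintype.card H : ℂ) ≠ 0 := by exact_mod_cast Fintype.card_ne_zero
  have key : ∀ x : G, (∑ h : H, if x * g * x⁻¹ = i h then
      (1 / (Fintype.card K : ℂ)) * ∑ y : H, ∑ k : K, (if y * h * y⁻¹ = j k then φ k else 0)
      else 0) = (1 / (Fintype.card K : ℂ)) * ∑ y : H, ∑ k : K,
        if (i y * x) * g * (i y * x)⁻¹ = i (j k) then φ k else 0 := by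
    intro x
    have h1 : ∀ h : H, (if x * g * x⁻¹ = i h then
      (1 / (Fintype.card K : ℂ)) * ∑ y : H, ∑ k : K, (if y * h * y⁻¹ = j k then φ k else 0)
      else 0) = (1 / (Fintype.card K : ℂ)) * ∑ y : H, ∑ k : K,
        if h = y⁻¹ * j k * y then (if x * g * x⁻¹ = i h then φ k else 0) else 0 := by
      intro h
      have h2 : ∀ (y : H) (k : K), (y * h * y⁻¹ = j k) = (h = y⁻¹ * j k * y) := by
        intro y k
        apply propext
        constructor
        · intro e; rw [← e]; group
        · intro e; rw [e]; group
      simp only [h2]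
      split_ifs <;> simp
    simp only [h1]
    rw [← Finset.mul_sum, Finset.sum_comm]
    congr 1
    refine Finset.sum_congr rfl fun y _ => ?_
    rw [Finset.sum_comm]
    refine Finset.sum_congr rfl fun k _ => ?_
    rw [Finset.sum_ite_eq' Finset.univ]
    simp only [Finset.mem_univ, if_true]
    congr 1
    apply propext
    simp only [map_mul, map_inv, mul_inv_rev]
    constructor
    · intro e
      calc i y * x * g * (x⁻¹ * (i y)⁻¹) = i y * (x * g * x⁻¹) * (i y)⁻¹ := by group
        _ = _ := by rw [e]; group
    · intro e
      rw [← e]; group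
  simp only [key]
  rw [← Finset.mul_sum, Finset.sum_comm]
  have h3 : ∀ y : H, (∑ x : G, ∑ k : K,
      if (i y * x) * g * (i y * x)⁻¹ = i (j k) then φ k else 0) =
      ∑ x : G, ∑ k : K, if x * g * x⁻¹ = (i.comp j) k then φ k else 0 := fun y =>
    Fintype.sum_equiv (Equiv.mulLeft (i y)) _ _ fun x => by simp
  simp only [h3, Finset.sum_const, Finset.card_univ, nsmul_eq_mul]
  field_simp

theorem ind_prodMap {H G H' G' : Type} [Group H] [Group G] [Group H'] [Group G']
    [Fintype H] [Fintype G] [Fintype H'] [Fintype G']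
    (i : H →* G) (j : H' →* G') (φ : H → ℂ) (ψ : H' → ℂ) :
    ind (i.prodMap j) (fun a => φ a.1 * ψ a.2) = fun g => ind i φ g.1 * ind j ψ g.2 := by
  classical
  funext g
  unfold ind
  rw [mul_mul_mul_comm, Finset.sum_mul_sum, Fintype.card_prod, Fintype.sum_prod_type]
  congr 1
  · push_cast
    rw [one_div_mul_one_div]
  refine Finset.sum_congr rfl fun x _ => Finset.sum_congr rfl fun y _ => ?_
  rw [Finset.sum_mul_sum, Fintype.sum_prod_type]
  refine Finset.sum_congr rfl fun a _ => Finset.sum_congr rfl fun b _ => ?_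
  simp only [MonoidHom.prodMap_def, Prod.ext_iff]
  by_cases h1 : x * g.1 * x⁻¹ = i a <;> by_cases h2 : y * g.2 * y⁻¹ = j b <;> simp [h1, h2]

theorem ind_id {G : Type} [Group G] [Fintype G] (φ : G → ℂ)
    (hφ : ∀ y g, φ (y * g * y⁻¹) = φ g) : ind (MonoidHom.id G) φ = φ := by
  classical
  funext g
  unfold ind
  have hG : (Fintype.card G : ℂ) ≠ 0 := by exact_mod_cast Fintype.card_ne_zero
  simp [hφ, hG]

theorem ind_transport {H G H' G' : Type} [Group H] [Group G] [Group H'] [Group G']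
    [Fintype H] [Fintype G] [Fintype H'] [Fintype G']
    (i : H →* G) (i' : H' →* G') (e : H ≃* H') (ε : G ≃* G')
    (hc : ∀ h, i' (e h) = ε (i h)) (φ : H → ℂ) (φ' : H' → ℂ) (hφ : ∀ h, φ' (e h) = φ h)
    (g : G) : ind i' φ' (ε g) = ind i φ g := by
  classical
  unfold ind
  rw [Fintype.card_congr e.toEquiv]
  congr 1
  symm
  refine Fintype.sum_equiv ε.toEquiv _ _ fun x => Fintype.sum_equiv e.toEquiv _ _ fun h => ?_
  simp only [MulEquiv.toEquiv_eq_coe, EquivLike.coe_coe, hφ, hc, ← map_mul, ← map_inv,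
    ε.injective.eq_iff]

/-! ### The graded algebra of `p`-regular class functions -/

/-- The group `GL_n(F_p)`. -/
abbrev GLp (p n : ℕ) : Type := Matrix.GeneralLinearGroup (Fin n) (ZMod p)

/-- The embedding `(a, b) ↦ diag(a, b)` of `GL_n × GL_m` in `GL_{n+m}`. -/
def blockDiag (p n m : ℕ) : GLp p n × GLp p m →* GLp p (n + m) :=
  (Units.map
    ({ toFun := fun a => Matrix.reindex finSumFinEquiv finSumFinEquiv
          (Matrix.fromBlocks a.1 0 0 a.2)
       map_one' := by simp [Matrix.fromBlocks_one]
       map_mul' := fun a b => by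
         simp [Matrix.submatrix_mul_equiv, Matrix.fromBlocks_multiply] } :
      Matrix (Fin n) (Fin n) (ZMod p) × Matrix (Fin m) (Fin m) (ZMod p) →*
        Matrix (Fin (n + m)) (Fin (n + m)) (ZMod p))).comp
    (MulEquiv.prodUnits.symm : GLp p n × GLp p m ≃* _).toMonoidHom

theorem blockDiag_val (p n m : ℕ) (a : GLp p n × GLp p m) :
    (blockDiag p n m a : Matrix (Fin (n + m)) (Fin (n + m)) (ZMod p)) =
      (Matrix.fromBlocks (a.1 : Matrix _ _ (ZMod p)) 0 0 (a.2 : Matrix _ _ (ZMod p))).submatrix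
        finSumFinEquiv.symm finSumFinEquiv.symm := rfl

/-- `p`-regular elements: those of order prime to `p`. -/
def PRegular (p : ℕ) {G : Type} [Group G] (g : G) : Prop := (orderOf g).Coprime p

/-- The space of complex class functions on `GL_n(F_p)` that vanish outside `p`-regular
elements. -/
def RegClassFun (p n : ℕ) : Submodule ℂ (GLp p n → ℂ) where
  carrier := {φ | (∀ h g, φ (h * g * h⁻¹) = φ g) ∧ ∀ g, ¬ PRegular p g → φ g = 0}
  zero_mem' := by simp
  add_mem' := fun ha hb => ⟨fun h g => by simp [ha.1, hb.1], fun g hg => by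
    simp [ha.2 g hg, hb.2 g hg]⟩
  smul_mem' := fun c a ha => ⟨fun h g => by simp [ha.1], fun g hg => by simp [ha.2 g hg]⟩

variable {p : ℕ} [Fact p.Prime]

/-- The induction product of `φ` on `GL_n(F_p)` and `ψ` on `GL_m(F_p)`: its value at `g` is
`1 / (|GL_n| |GL_m|)` times the sum of `φ a * ψ b` over the `h` in `GL_{n+m}(F_p)` for which
`h * g * h⁻¹` is block diagonal, with diagonal blocks `a` and `b`. -/
def indMul {n m : ℕ} (φ : RegClassFun p n) (ψ : RegClassFun p m) : RegClassFun p (n + m) :=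
  ⟨ind (blockDiag p n m) fun a => φ.1 a.1 * ψ.1 a.2, fun h g => ind_conj _ _ h g, by
    classical
    intro g hg
    unfold ind
    refine mul_eq_zero_of_right _ (Finset.sum_eq_zero fun x _ => Finset.sum_eq_zero fun a _ => ?_)
    split_ifs with hx
    · by_cases h1 : PRegular p a.1
      · by_cases h2 : PRegular p a.2
        · refine absurd ?_ hg
          have h3 : orderOf (x * g * x⁻¹) = orderOf g :=
            orderOf_injective (MulAut.conj x).toMonoidHom (MulAut.conj x).injective g
          unfold PRegular
          rw [← h3, hx]
          refine Nat.Coprime.of_dvd_left (orderOf_map_dvd _ a) ?_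
          rw [Prod.orderOf]
          exact Nat.Coprime.of_dvd_left (Nat.lcm_dvd_mul _ _) (Nat.Coprime.mul_left h1 h2)
        · exact mul_eq_zero_of_right _ (ψ.2.2 _ h2)
      · exact mul_eq_zero_of_left (φ.2.2 _ h1) _
    · rfl⟩

/-- The unit of the product: the constant function `1` on the trivial group `GL_0(F_p)`. -/
def indOne : RegClassFun p 0 :=
  ⟨fun _ => 1, fun _ _ => rfl, fun g hg => absurd (by
    have : g = 1 := Subsingleton.elim _ _
    simp [PRegular, this]) hg⟩

/-- Transport of `GL` along an equality of sizes. -/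
def castGL {N N' : ℕ} (h : N = N') : GLp p N ≃* GLp p N' :=
  Units.mapEquiv (Matrix.reindexAlgEquiv (ZMod p) (ZMod p) (finCongr h)).toMulEquiv

theorem castGL_val {N N' : ℕ} (h : N = N') (g : GLp p N) :
    (castGL h g : Matrix (Fin N') (Fin N') (ZMod p)) =
      (g : Matrix _ _ (ZMod p)).submatrix (finCongr h).symm (finCongr h).symm := rfl

theorem mk_eq {N N' : ℕ} (h : N = N') (φ : RegClassFun p N) (φ' : RegClassFun p N')
    (hφ : ∀ g, φ'.1 (castGL h g) = φ.1 g) :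
    GradedMonoid.mk (A := fun n => RegClassFun p n) N φ = GradedMonoid.mk N' φ' := by
  subst h
  have h1 : ∀ g : GLp p N, castGL rfl g = g := fun g => Units.ext (by
    rw [castGL_val]; ext; simp)
  congr 1
  apply Subtype.ext
  funext g
  rw [← hφ, h1]

theorem blocks_assoc {n m k : ℕ} (a : GLp p n) (b : GLp p m) (c : GLp p k) :
    (blockDiag p n (m + k) (a, blockDiag p m k (b, c))).val =
      (castGL (add_assoc n m k) (blockDiag p (n + m) k (blockDiag p n m (a, b), c))).val := by
  have e1 : ∀ i : Fin n, (finCongr (add_assoc n m k)).symm (finSumFinEquiv (Sum.inl i)) =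
      finSumFinEquiv (Sum.inl (finSumFinEquiv (Sum.inl i))) := fun i => Fin.ext (by simp)
  have e2 : ∀ i : Fin m, (finCongr (add_assoc n m k)).symm
      (finSumFinEquiv (Sum.inr (finSumFinEquiv (Sum.inl i)))) =
      finSumFinEquiv (Sum.inl (finSumFinEquiv (Sum.inr i))) := fun i => Fin.ext (by simp)
  have e3 : ∀ i : Fin k, (finCongr (add_assoc n m k)).symm
      (finSumFinEquiv (Sum.inr (finSumFinEquiv (Sum.inr i)))) =
      finSumFinEquiv (Sum.inr i) := fun i => Fin.ext (by simp [add_assoc])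
  rw [castGL_val]
  simp only [blockDiag_val]
  ext i j
  obtain ⟨i, rfl⟩ := finSumFinEquiv.surjective i
  obtain ⟨j, rfl⟩ := finSumFinEquiv.surjective j
  rcases i with i | i
  · rcases j with j | j
    · simp only [Matrix.submatrix_apply, e1, Equiv.symm_apply_apply, Matrix.fromBlocks_apply₁₁]
    · obtain ⟨j, rfl⟩ := finSumFinEquiv.surjective j
      rcases j with j | j <;>
      simp only [Matrix.submatrix_apply, e1, e2, e3, Equiv.symm_apply_apply,
        Matrix.fromBlocks_apply₁₁, Matrix.fromBlocks_apply₁₂, Matrix.zero_apply]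
  · obtain ⟨i, rfl⟩ := finSumFinEquiv.surjective i
    rcases j with j | j
    · rcases i with i | i <;>
      simp only [Matrix.submatrix_apply, e1, e2, e3, Equiv.symm_apply_apply,
        Matrix.fromBlocks_apply₁₁, Matrix.fromBlocks_apply₂₁, Matrix.zero_apply]
    · obtain ⟨j, rfl⟩ := finSumFinEquiv.surjective j
      rcases i with i | i <;> rcases j with j | j <;>
      simp only [Matrix.submatrix_apply, e2, e3, Equiv.symm_apply_apply,
        Matrix.fromBlocks_apply₁₁, Matrix.fromBlocks_apply₁₂, Matrix.fromBlocks_apply₂₁,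
        Matrix.fromBlocks_apply₂₂, Matrix.zero_apply]

theorem indMul_assoc {n m k : ℕ} (φ : RegClassFun p n) (ψ : RegClassFun p m)
    (χ : RegClassFun p k) :
    GradedMonoid.mk (A := fun n => RegClassFun p n) (n + m + k) (indMul (indMul φ ψ) χ) =
      GradedMonoid.mk (n + (m + k)) (indMul φ (indMul ψ χ)) := by
  refine mk_eq (add_assoc n m k) _ _ fun g => ?_
  have hl : (indMul (indMul φ ψ) χ).1 =
      ind ((blockDiag p (n + m) k).comp ((blockDiag p n m).prodMap (MonoidHom.id _)))
        (fun a => (φ.1 a.1.1 * ψ.1 a.1.2) * χ.1 a.2) := by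
    rw [← ind_comp, ind_prodMap (blockDiag p n m) (MonoidHom.id _)
      (fun a => φ.1 a.1 * ψ.1 a.2) χ.1, ind_id χ.1 χ.2.1]
    rfl
  have hr : (indMul φ (indMul ψ χ)).1 =
      ind ((blockDiag p n (m + k)).comp ((MonoidHom.id _).prodMap (blockDiag p m k)))
        (fun a => φ.1 a.1 * (ψ.1 a.2.1 * χ.1 a.2.2)) := by
    rw [← ind_comp, ind_prodMap (MonoidHom.id _) (blockDiag p m k) φ.1
      (fun a => ψ.1 a.1 * χ.1 a.2), ind_id φ.1 φ.2.1]
    rfl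
  rw [hl, hr]
  refine ind_transport _ _ MulEquiv.prodAssoc _ ?_ _ _ ?_ g
  · rintro ⟨⟨a, b⟩, c⟩
    exact Units.ext (blocks_assoc a b c)
  · rintro ⟨⟨a, b⟩, c⟩
    exact (mul_assoc _ _ _).symm

theorem indOne_mul {n : ℕ} (φ : RegClassFun p n) :
    GradedMonoid.mk (A := fun n => RegClassFun p n) (0 + n) (indMul indOne φ) =
      GradedMonoid.mk n φ := by
  refine mk_eq (zero_add n) _ _ fun g => ?_
  rw [← ind_id φ.1 φ.2.1]
  refine ind_transport _ _ MulEquiv.uniqueProd (castGL (zero_add n)) ?_ _ _ ?_ g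
  · rintro ⟨a, b⟩
    apply Units.ext
    rw [castGL_val, blockDiag_val]
    have e1 : ∀ i : Fin n, (finCongr (zero_add n)).symm i = finSumFinEquiv (Sum.inr i) :=
      fun i => Fin.ext (by simp)
    ext i j
    simp only [Matrix.submatrix_apply, e1, Equiv.symm_apply_apply, Matrix.fromBlocks_apply₂₂]
    rfl
  · rintro ⟨a, b⟩
    exact (one_mul _).symm

theorem indMul_one {n : ℕ} (φ : RegClassFun p n) :
    GradedMonoid.mk (A := fun n => RegClassFun p n) (n + 0) (indMul φ indOne) =
      GradedMonoid.mk n φ := by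
  refine mk_eq (add_zero n) _ _ fun g => ?_
  rw [← ind_id φ.1 φ.2.1]
  refine ind_transport _ _ MulEquiv.prodUnique (castGL (add_zero n)) ?_ _ _ ?_ g
  · rintro ⟨a, b⟩
    apply Units.ext
    rw [castGL_val, blockDiag_val]
    have e1 : ∀ i : Fin n, (finCongr (add_zero n)).symm i = finSumFinEquiv (Sum.inl i) :=
      fun i => Fin.ext (by rw [finSumFinEquiv_apply_left]; rfl)
    ext i j
    simp only [Matrix.submatrix_apply, e1, Equiv.symm_apply_apply, Matrix.fromBlocks_apply₁₁]
    rfl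
  · rintro ⟨a, b⟩
    exact (mul_one _).symm

theorem ind_add {H G : Type} [Group H] [Group G] [Fintype H] [Fintype G]
    (i : H →* G) (φ ψ : H → ℂ) (g : G) :
    ind i (fun a => φ a + ψ a) g = ind i φ g + ind i ψ g := by
  classical
  unfold ind
  rw [← mul_add, ← Finset.sum_add_distrib]
  congr 1
  refine Finset.sum_congr rfl fun x _ => ?_
  rw [← Finset.sum_add_distrib]
  refine Finset.sum_congr rfl fun h _ => ?_
  split_ifs <;> simp

theorem ind_zero {H G : Type} [Group H] [Group G] [Fintype H] [Fintype G]
    (i : H →* G) (g : G) : ind i (fun _ => 0) g = 0 := by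
  simp [ind]

theorem indMul_zero {n m : ℕ} (φ : RegClassFun p n) : indMul φ (0 : RegClassFun p m) = 0 := by
  apply Subtype.ext
  funext g
  refine Eq.trans (congrArg (fun F => ind (blockDiag p n m) F g) ?_) (ind_zero _ g)
  funext a
  exact mul_zero _

theorem zero_indMul {n m : ℕ} (ψ : RegClassFun p m) : indMul (0 : RegClassFun p n) ψ = 0 := by
  apply Subtype.ext
  funext g
  refine Eq.trans (congrArg (fun F => ind (blockDiag p n m) F g) ?_) (ind_zero _ g)
  funext a
  exact zero_mul _

theorem indMul_add {n m : ℕ} (φ : RegClassFun p n) (ψ χ : RegClassFun p m) :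
    indMul φ (ψ + χ) = indMul φ ψ + indMul φ χ := by
  apply Subtype.ext
  funext g
  refine Eq.trans (congrArg (fun F => ind (blockDiag p n m) F g) ?_) (ind_add _ _ _ g)
  funext a
  exact mul_add _ _ _

theorem add_indMul {n m : ℕ} (φ ψ : RegClassFun p n) (χ : RegClassFun p m) :
    indMul (φ + ψ) χ = indMul φ χ + indMul ψ χ := by
  apply Subtype.ext
  funext g
  refine Eq.trans (congrArg (fun F => ind (blockDiag p n m) F g) ?_) (ind_add _ _ _ g)
  funext a
  exact add_mul _ _ _

instance : GradedMonoid.GOne (fun n => RegClassFun p n) where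
  one := indOne

instance : GradedMonoid.GMul (fun n => RegClassFun p n) where
  mul := indMul

instance : GradedMonoid.GMonoid (fun n => RegClassFun p n) where
  one_mul := fun ⟨_, φ⟩ => indOne_mul φ
  mul_one := fun ⟨_, φ⟩ => indMul_one φ
  mul_assoc := fun ⟨_, φ⟩ ⟨_, ψ⟩ ⟨_, χ⟩ => indMul_assoc φ ψ χ

/-- The induction product makes the direct sum over `n` of the spaces `RegClassFun p n` a
ring. -/
instance : DirectSum.GSemiring (fun n => RegClassFun p n) where
  mul_zero := indMul_zero
  zero_mul := zero_indMul
  mul_add := indMul_add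
  add_mul := add_indMul
  natCast k := k • indOne
  natCast_zero := zero_smul _ _
  natCast_succ k := succ_nsmul _ k

/-- The graded algebra of `p`-regular class functions on the groups `GL_n(F_p)`, `n ≥ 0`, with
the induction product. -/
abbrev RegAlg (p : ℕ) : Type := DirectSum ℕ fun n => RegClassFun p n

/-- The function `π_f` on `GL_n(F_p)`, where `n` is the degree of `f`: it is `1` on the
`p`-regular elements with characteristic polynomial `f` and `0` elsewhere. -/
def piFun (f : (ZMod p)[X]) : RegClassFun p f.natDegree :=
  open Classical in
  ⟨fun g => if PRegular p g ∧ g.val.charpoly = f then 1 else 0, by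
    classical
    intro h g
    have h1 : orderOf (h * g * h⁻¹) = orderOf g :=
      orderOf_injective (MulAut.conj h).toMonoidHom (MulAut.conj h).injective g
    have h2 : (h * g * h⁻¹).val.charpoly =
        g.val.charpoly := by
      rw [Units.val_mul, Units.val_mul, Matrix.coe_units_inv, Matrix.charpoly_units_conj]
    exact if_congr (by rw [PRegular, PRegular, h1, h2]) rfl rfl, by
    intro g hg
    exact if_neg fun h => hg h.1⟩

/-- `π_f` as a homogeneous element of the graded algebra. -/
def piElt (f : (ZMod p)[X]) : RegAlg p :=
  DirectSum.of (fun n => RegClassFun p n) f.natDegree (piFun f)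

/-- `ψ_k(q) = ∏_{i = 1}^k (q ^ i - 1)`. -/
def psi (k : ℕ) (q : ℂ) : ℂ := ∏ i ∈ Finset.Icc 1 k, (q ^ i - 1)

end

end GLInduction

/-!
Let `K = F_p[X] / (f)`, a field with `q = p ^ d` elements, and let `g` be a `p`-regular element of
`GL_{nd}(F_p)` with characteristic polynomial `f ^ n`. As `g` is a root of the separable polynomial
`X ^ m - 1`, where `m` is its order, its minimal polynomial is squarefree, and so `f` annihilates
`g` (`aeval_eq_zero_of_pRegular`). Hence `F_p ^ {nd}` becomes a vector space over `K` of dimension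
`n` on which `g` is multiplication by the root of `f` (`exists_linearEquiv_adjoinRoot`). It follows
that for two such elements `g` and `g'` the matrices `h` with `h * g * h⁻¹ = g'` correspond to the
automorphisms of `K ^ n`, so that there are `γ_n = |GL_n(K)|` of them (`card_transporter`). In
particular such elements form a single conjugacy class (nonempty by
`exists_pRegular_charpoly_eq_pow`), of size `|GL_{nd}(F_p)| / γ_n` (`sum_piFun_pow`).

The value of `π_{f ^ n} * π_f` at a `p`-regular element with characteristic polynomial
`f ^ (n + 1)` is therefore `γ_{n + 1}` times the product of the sizes of the classes of types `f ^ n`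
and `f`, divided by `|GL_{nd}(F_p)| |GL_d(F_p)|`, that is `γ_{n + 1} / (γ_n γ_1)`
(`indMul_piFun_pow`). By induction `π_f ^ n = (γ_n / γ_1 ^ n) π_{f ^ n}`, and
`γ_n = q ^ (n choose 2) ψ_n(q)` (`natCard_GL_adjoinRoot`) gives the stated coefficient.
-/

namespace GLInduction

/-! ### Regularity and characteristic polynomials in general linear groups -/

theorem pRegular_map {p : ℕ} {G H : Type} [Group G] [Group H] (φ : G →* H) {g : G}
    (hg : PRegular p g) : PRegular p (φ g) :=
  Nat.Coprime.of_dvd_left (orderOf_map_dvd φ g) hg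

theorem pRegular_prodMk {p : ℕ} {G H : Type} [Group G] [Group H] {a : G} {b : H}
    (ha : PRegular p a) (hb : PRegular p b) : PRegular p (a, b) := by
  unfold PRegular
  rw [Prod.orderOf]
  exact Nat.Coprime.of_dvd_left (Nat.lcm_dvd_mul _ _) (Nat.Coprime.mul_left ha hb)

theorem pRegular_mulEquiv_iff {p : ℕ} {G H : Type} [Group G] [Group H] (e : G ≃* H) (g : G) :
    PRegular p (e g) ↔ PRegular p g := by
  rw [PRegular, PRegular, MulEquiv.orderOf_eq]

theorem charpoly_castGL {p : ℕ} [Fact p.Prime] {N N' : ℕ} (h : N = N') (g : GLp p N) :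
    (castGL h g).val.charpoly = g.val.charpoly :=
  Matrix.charpoly_reindex (finCongr h) g.val

theorem charpoly_blockDiag {p : ℕ} [Fact p.Prime] {n m : ℕ} (a : GLp p n × GLp p m) :
    (blockDiag p n m a).val.charpoly = a.1.val.charpoly * a.2.val.charpoly := by
  rw [← Matrix.charpoly_fromBlocks_zero₁₂ a.1.val 0 a.2.val]
  exact Matrix.charpoly_reindex finSumFinEquiv _

theorem charpoly_conj {p : ℕ} [Fact p.Prime] {N : ℕ} (h g : GLp p N) :
    (h * g * h⁻¹).val.charpoly = g.val.charpoly := by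
  rw [Units.val_mul, Units.val_mul, Matrix.coe_units_inv, Matrix.charpoly_units_conj]

theorem pRegular_and_charpoly_eq_one {p : ℕ} [Fact p.Prime] {N : ℕ} (hN : N = 0) (g : GLp p N) :
    PRegular p g ∧ g.val.charpoly = 1 := by
  subst hN
  rw [Subsingleton.elim g 1]
  exact ⟨by simp [PRegular], Matrix.det_isEmpty⟩

/-! ### Vector spaces with an endomorphism annihilated by an irreducible polynomial -/

/-- A `p`-regular matrix whose characteristic polynomial is a power of an irreducible `f` is
annihilated by `f`: its minimal polynomial divides the separable polynomial `X ^ m - 1`, hence is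
squarefree, and it divides a power of `f`. -/
theorem aeval_eq_zero_of_pRegular {p : ℕ} [Fact p.Prime] {N n : ℕ} {f : (ZMod p)[X]}
    {g : GLp p N} (hreg : PRegular p g) (hg : g.val.charpoly = f ^ n) :
    aeval g.val f = 0 := by
  have hpow : g.val ^ orderOf g = 1 := by
    rw [← Units.val_pow_eq_pow_val, pow_orderOf_eq_one, Units.val_one]
  have hm : ((orderOf g : ℕ) : ZMod p) ≠ 0 := by
    rw [Ne, ZMod.natCast_eq_zero_iff]
    exact (Nat.Prime.coprime_iff_not_dvd Fact.out).1 (Nat.Coprime.symm hreg)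
  have hsq : Squarefree (minpoly (ZMod p) g.val) :=
    (X_pow_sub_one_separable_iff.2 hm).squarefree.squarefree_of_dvd
      (minpoly.dvd _ _ (by simp [hpow]))
  have hdvd : minpoly (ZMod p) g.val ∣ f ^ n := hg ▸ Matrix.minpoly_dvd_charpoly _
  -- Passing to `f ^ (n + 1)` makes the exponent nonzero also when `n = 0`.
  have hdvd' : minpoly (ZMod p) g.val ∣ f :=
    (hsq.dvd_pow_iff_dvd n.succ_ne_zero).1 (hdvd.trans (pow_dvd_pow f n.le_succ))
  obtain ⟨c, hc⟩ := hdvd'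
  rw [hc, map_mul, minpoly.aeval, zero_mul]

/-- A vector space over `F` with an endomorphism annihilated by an irreducible `f` is a vector
space over the field `F[X] / (f)`; hence it is isomorphic to a power of that field, in such a way
that the endomorphism becomes multiplication by the root of `f`. -/
theorem exists_linearEquiv_adjoinRoot {F V : Type*} [Field F] [AddCommGroup V] [Module F V]
    [FiniteDimensional F V] {f : F[X]} (hf : Irreducible f) {n : ℕ}
    (hV : Module.finrank F V = n * f.natDegree) (T : Module.End F V) (hT : aeval T f = 0) :
    ∃ e : V ≃ₗ[F] (Fin n → AdjoinRoot f), ∀ v, e (T v) = AdjoinRoot.root f • e v := by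
  have : Fact (Irreducible f) := ⟨hf⟩
  let Φ : AdjoinRoot f →ₐ[F] Module.End F V :=
    Ideal.Quotient.liftₐ (Ideal.span {f}) (aeval T) fun a ha => by
      obtain ⟨c, rfl⟩ := Ideal.mem_span_singleton'.1 ha
      rw [map_mul, hT, mul_zero]
  have hroot : Φ (AdjoinRoot.root f) = T := by
    change aeval T X = T
    simp
  let _ : Module (AdjoinRoot f) V := Module.compHom V Φ.toRingHom
  have hsmul : ∀ (k : AdjoinRoot f) (v : V), k • v = Φ k v := fun _ _ => rfl
  have : IsScalarTower F (AdjoinRoot f) V := ⟨fun a k v => by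
    rw [hsmul, hsmul, map_smul, LinearMap.smul_apply]⟩
  have : Module.Finite F (AdjoinRoot f) := (AdjoinRoot.powerBasis hf.ne_zero).finite
  have : Module.Finite (AdjoinRoot f) V := Module.Finite.of_restrictScalars_finite F _ _
  have hd : Module.finrank F (AdjoinRoot f) = f.natDegree := by
    rw [(AdjoinRoot.powerBasis hf.ne_zero).finrank, AdjoinRoot.powerBasis_dim]
  have hn : Module.finrank (AdjoinRoot f) V = n := by
    have h := Module.finrank_mul_finrank F (AdjoinRoot f) V
    rw [hd, hV, mul_comm] at h
    exact Nat.eq_of_mul_eq_mul_right hf.natDegree_pos h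
  have e : V ≃ₗ[AdjoinRoot f] (Fin n → AdjoinRoot f) :=
    LinearEquiv.ofFinrankEq _ _ (hn.trans (Module.finrank_fin_fun _).symm)
  refine ⟨e.restrictScalars F, fun v => ?_⟩
  have h : T v = AdjoinRoot.root f • v := by rw [hsmul, hroot]
  rw [h]
  exact map_smul e _ v

/-- An additive map between modules over `F[X] / (f)` that is linear over `F` and commutes with
the root is linear over `F[X] / (f)`. -/
theorem map_smul_of_map_root_smul {F W W' : Type*} [Field F] {f : F[X]}
    [AddCommGroup W] [AddCommGroup W'] [Module F W] [Module F W'] [Module (AdjoinRoot f) W]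
    [Module (AdjoinRoot f) W'] [IsScalarTower F (AdjoinRoot f) W]
    [IsScalarTower F (AdjoinRoot f) W'] (u : W →ₗ[F] W')
    (hu : ∀ w, u (AdjoinRoot.root f • w) = AdjoinRoot.root f • u w) (k : AdjoinRoot f) (w : W) :
    u (k • w) = k • u w := by
  have hk : k ∈ Algebra.adjoin F {AdjoinRoot.root f} := by
    rw [AdjoinRoot.adjoinRoot_eq_top]; trivial
  induction hk using Algebra.adjoin_induction generalizing w with
  | mem x hx => rw [Set.mem_singleton_iff.1 hx, hu]
  | algebraMap r => rw [algebraMap_smul, algebraMap_smul, map_smul]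
  | add x y _ _ hx hy => rw [add_smul, map_add, hx, hy, add_smul]
  | mul x y _ _ hx hy => rw [mul_smul, hx, hy, mul_smul]

/-- The number of matrices conjugating `g` into `g'`, where both are annihilated by `f`. In
suitable coordinates both `g` and `g'` are multiplication by the root of `f`, and then the
conjugating matrices are the automorphisms of `(F[X] / (f)) ^ n`. -/
theorem card_transporter {p : ℕ} [Fact p.Prime] {f : (ZMod p)[X]} (hf : Irreducible f)
    {N n : ℕ} (hN : N = n * f.natDegree) {g g' : GLp p N} (hg : aeval g.val f = 0)
    (hg' : aeval g'.val f = 0) :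
    Nat.card {h : GLp p N // h * g * h⁻¹ = g'} = Nat.card (GL (Fin n) (AdjoinRoot f)) := by
  have : Fact (Irreducible f) := ⟨hf⟩
  have key : ∀ a : GLp p N, aeval a.val f = 0 →
      ∃ e : (Fin N → ZMod p) ≃ₗ[ZMod p] (Fin n → AdjoinRoot f),
        ∀ v, e (a.val.mulVec v) = AdjoinRoot.root f • e v := fun a ha => by
    refine exists_linearEquiv_adjoinRoot hf (by simpa using hN) (Matrix.toLinAlgEquiv' a.val) ?_
    rw [aeval_algHom_apply, ha, map_zero]
  obtain ⟨e, he⟩ := key g hg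
  obtain ⟨e', he'⟩ := key g' hg'
  let L : GLp p N ≃* ((Fin N → ZMod p) ≃ₗ[ZMod p] (Fin N → ZMod p)) :=
    Matrix.GeneralLinearGroup.toLin.trans (LinearMap.GeneralLinearGroup.generalLinearEquiv _ _)
  have hL : ∀ (h : GLp p N) v, L h v = h.val.mulVec v := fun _ _ => rfl
  -- `E u` is the matrix that is given by `u` in the coordinates `e` and `e'`.
  let E : ((Fin n → AdjoinRoot f) ≃ₗ[AdjoinRoot f] (Fin n → AdjoinRoot f)) → GLp p N :=
    fun u => L.symm (e ≪≫ₗ u.restrictScalars (ZMod p) ≪≫ₗ e'.symm)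
  have hE : ∀ u v, e' (L (E u) v) = u (e v) := fun u v => by simp [E]
  have hinj : Function.Injective E := fun u u' h => by
    ext1 w
    obtain ⟨v, rfl⟩ := e.surjective w
    rw [← hE, ← hE, h]
  have hiff : ∀ h : GLp p N, h * g * h⁻¹ = g' ↔
      ∀ v, L h (g.val.mulVec v) = g'.val.mulVec (L h v) := fun h => by
    rw [mul_inv_eq_iff_eq_mul, ← L.injective.eq_iff, LinearEquiv.ext_iff]
    simp only [map_mul, LinearEquiv.mul_apply, hL]
  have hrange : Set.range E = {h | h * g * h⁻¹ = g'} := by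
    ext h
    rw [Set.mem_ofPred_eq, hiff]
    constructor
    · rintro ⟨u, rfl⟩ v
      apply e'.injective
      rw [hE, he, he', hE, map_smul]
    · intro hh
      let u₀ : (Fin n → AdjoinRoot f) ≃ₗ[ZMod p] (Fin n → AdjoinRoot f) :=
        e.symm ≪≫ₗ L h ≪≫ₗ e'
      have hu₀ : ∀ k w, u₀ (k • w) = k • u₀ w := map_smul_of_map_root_smul u₀.toLinearMap
        fun w => by
          obtain ⟨v, rfl⟩ := e.surjective w
          rw [← he]
          simp [u₀, hh, he']
      refine ⟨{ u₀ with map_smul' := hu₀ }, L.injective (LinearEquiv.ext fun v => ?_)⟩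
      apply e'.injective
      rw [hE]
      change u₀ (e v) = _
      simp [u₀]
  calc Nat.card {h : GLp p N // h * g * h⁻¹ = g'}
      = Nat.card (Set.range E) := by rw [hrange]; rfl
    _ = Nat.card ((Fin n → AdjoinRoot f) ≃ₗ[AdjoinRoot f] (Fin n → AdjoinRoot f)) :=
      (Nat.card_congr (Equiv.ofInjective E hinj)).symm
    _ = _ := (Nat.card_congr (Matrix.GeneralLinearGroup.toLin.trans
      (LinearMap.GeneralLinearGroup.generalLinearEquiv _ _)).toEquiv).symm

/-! ### The field `F_p[X] / (f)` and its general linear groups -/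

theorem finite_adjoinRoot {p : ℕ} [Fact p.Prime] {f : (ZMod p)[X]} (hf : f ≠ 0) :
    Finite (AdjoinRoot f) :=
  have := (AdjoinRoot.powerBasis hf).finite
  Module.finite_of_finite (ZMod p)

theorem natCard_GL_adjoinRoot_ne_zero {p : ℕ} [Fact p.Prime] {f : (ZMod p)[X]} (hf : f ≠ 0)
    (n : ℕ) : (Nat.card (GL (Fin n) (AdjoinRoot f)) : ℂ) ≠ 0 := by
  have := finite_adjoinRoot hf
  exact_mod_cast Nat.card_pos.ne'

theorem natCard_adjoinRoot {p : ℕ} [Fact p.Prime] {f : (ZMod p)[X]} (hf : f ≠ 0) :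
    Nat.card (AdjoinRoot f) = p ^ f.natDegree := by
  let b := AdjoinRoot.powerBasis hf
  have := b.finite
  rw [Module.natCard_eq_pow_finrank (K := ZMod p), b.finrank, AdjoinRoot.powerBasis_dim,
    Nat.card_zmod]

/-- The order of `GL_n` over `F_p[X] / (f)`. -/
theorem natCard_GL_adjoinRoot {p : ℕ} [Fact p.Prime] {f : (ZMod p)[X]} (hf : Irreducible f)
    (n : ℕ) : (Nat.card (GL (Fin n) (AdjoinRoot f)) : ℂ) =
      (p : ℂ) ^ (f.natDegree * n.choose 2) * psi n ((p : ℂ) ^ f.natDegree) := by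
  have : Fact (Irreducible f) := ⟨hf⟩
  have : Finite (AdjoinRoot f) := finite_adjoinRoot hf.ne_zero
  have := Fintype.ofFinite (AdjoinRoot f)
  rw [Matrix.card_GL_field, Fintype.card_eq_nat_card, natCard_adjoinRoot hf.ne_zero, pow_mul]
  set q := p ^ f.natDegree with hq
  have hq1 : 1 ≤ q := Nat.one_le_pow _ _ (Nat.Prime.pos Fact.out)
  have hqc : (p : ℂ) ^ f.natDegree = (q : ℂ) := by rw [hq]; push_cast; rfl
  have hterm : ∀ i : Fin n, ((q ^ n - q ^ (i : ℕ) : ℕ) : ℂ) =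
      (q : ℂ) ^ (i : ℕ) * ((q : ℂ) ^ (n - i) - 1) := fun i => by
    rw [Nat.cast_sub (Nat.pow_le_pow_right hq1 i.2.le), mul_sub, ← pow_add,
      Nat.add_sub_cancel' i.2.le]
    push_cast
    ring
  rw [hqc, Nat.cast_prod, Finset.prod_congr rfl fun i _ => hterm i, Finset.prod_mul_distrib,
    Fin.prod_univ_eq_prod_range (fun i => (q : ℂ) ^ i),
    Fin.prod_univ_eq_prod_range (fun i => (q : ℂ) ^ (n - i) - 1), Finset.prod_pow_eq_pow_sum,
    Finset.sum_range_id, ← Nat.choose_two_right]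
  congr 1
  unfold psi
  -- The exponents `n - i`, for `i < n`, run through `1, …, n`.
  refine Finset.prod_nbij' (n - ·) (n - ·) ?_ ?_ ?_ ?_ fun _ _ => rfl <;>
  · intro i hi
    simp only [Finset.mem_range, Finset.mem_Icc] at hi ⊢
    omega

/-! ### Existence of `p`-regular elements with characteristic polynomial `f ^ n` -/

/-- Multiplication by the root on `F_p[X] / (f)` is a `p`-regular matrix with characteristic
polynomial `f`, since the multiplicative group of a field with `p ^ d` elements has order
`p ^ d - 1`. -/
theorem exists_pRegular_charpoly_eq {p : ℕ} [Fact p.Prime] {f : (ZMod p)[X]} (hmonic : f.Monic)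
    (hf : Irreducible f) (h0 : f.coeff 0 ≠ 0) :
    ∃ g : GLp p f.natDegree, PRegular p g ∧ g.val.charpoly = f := by
  have : Fact (Irreducible f) := ⟨hf⟩
  let b := AdjoinRoot.powerBasis hf.ne_zero
  have : Finite (AdjoinRoot f) := finite_adjoinRoot hf.ne_zero
  -- The root vanishes only if `f` has constant coefficient `0`.
  have hroot : AdjoinRoot.root f ≠ 0 := fun h => by
    have h1 := AdjoinRoot.eval₂_root f
    rw [h, eval₂_at_zero] at h1
    exact h0 ((map_eq_zero _).1 h1)
  let α : (AdjoinRoot f)ˣ := Units.mk0 _ hroot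
  have hα : PRegular p α := by
    refine Nat.Coprime.of_dvd_left (orderOf_dvd_natCard α) ?_
    rw [Nat.card_units, natCard_adjoinRoot hf.ne_zero]
    refine ((Nat.Prime.coprime_iff_not_dvd Fact.out).2 fun h => ?_).symm
    have hp : p.Prime := Fact.out
    have h2 : p ∣ p ^ f.natDegree := dvd_pow_self p hf.natDegree_pos.ne'
    have h3 : p ∣ p ^ f.natDegree - (p ^ f.natDegree - 1) := Nat.dvd_sub h2 h
    rw [Nat.sub_sub_self (Nat.one_le_pow _ _ hp.pos)] at h3
    exact hp.one_lt.ne' (Nat.dvd_one.1 h3)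
  let e : Fin b.dim ≃ Fin f.natDegree := finCongr (AdjoinRoot.powerBasis_dim hf.ne_zero)
  let φ : AdjoinRoot f →* Matrix (Fin f.natDegree) (Fin f.natDegree) (ZMod p) :=
    (Algebra.leftMulMatrix (b.basis.reindex e)).toMonoidHom
  refine ⟨Units.map φ α, pRegular_map _ hα, ?_⟩
  change (Algebra.leftMulMatrix (b.basis.reindex e) (AdjoinRoot.root f)).charpoly = f
  have h1 := charpoly_leftMulMatrix b
  rw [AdjoinRoot.minpoly_powerBasis_gen_of_monic hmonic] at h1
  rw [AdjoinRoot.powerBasis_gen, ← Matrix.charpoly_reindex e] at h1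
  refine Eq.trans (congrArg _ ?_) h1
  ext i j
  simp [Algebra.leftMulMatrix_eq_repr_mul]

theorem exists_pRegular_charpoly_eq_pow {p : ℕ} [Fact p.Prime] {f : (ZMod p)[X]}
    (hmonic : f.Monic) (hf : Irreducible f) (h0 : f.coeff 0 ≠ 0) (n : ℕ) :
    ∃ g : GLp p (f ^ n).natDegree, PRegular p g ∧ g.val.charpoly = f ^ n := by
  induction n with
  | zero =>
    rw [pow_zero]
    exact ⟨1, pRegular_and_charpoly_eq_one natDegree_one 1⟩
  | succ n ih =>
    obtain ⟨a, ha, ha'⟩ := ih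
    obtain ⟨b, hb, hb'⟩ := exists_pRegular_charpoly_eq hmonic hf h0
    have h : (f ^ n).natDegree + f.natDegree = (f ^ (n + 1)).natDegree := by
      rw [pow_succ, ((hmonic.pow n).natDegree_mul hmonic)]
    refine ⟨castGL h (blockDiag p _ _ (a, b)),
      (pRegular_mulEquiv_iff _ _).2 (pRegular_map _ (pRegular_prodMk ha hb)), ?_⟩
    rw [charpoly_castGL, charpoly_blockDiag, ha', hb', pow_succ]

/-! ### The product of `π_{f ^ n}` and `π_f` -/

/-- The values of `π_{f ^ n}` sum to the size of a single conjugacy class, which is the quotient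
of the orders of the general linear group and of a centralizer. -/
theorem sum_piFun_pow {p : ℕ} [Fact p.Prime] {f : (ZMod p)[X]} (hmonic : f.Monic)
    (hf : Irreducible f) (h0 : f.coeff 0 ≠ 0) (n : ℕ) :
    (∑ g, (piFun (f ^ n)).1 g) * (Nat.card (GL (Fin n) (AdjoinRoot f)) : ℂ) =
      Fintype.card (GLp p (f ^ n).natDegree) := by
  classical
  obtain ⟨g₀, hg₀, hg₀'⟩ := exists_pRegular_charpoly_eq_pow hmonic hf h0 n
  have hN : (f ^ n).natDegree = n * f.natDegree := natDegree_pow _ _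
  -- Sort the elements `h` by the conjugate of `g₀` that they produce.
  have key : ∀ g, (piFun (f ^ n)).1 g * (Nat.card (GL (Fin n) (AdjoinRoot f)) : ℂ) =
      ∑ h, if h * g₀ * h⁻¹ = g then 1 else 0 := fun g => by
    by_cases hg : PRegular p g ∧ g.val.charpoly = f ^ n
    · rw [← card_transporter hf hN (aeval_eq_zero_of_pRegular hg₀ hg₀')
        (aeval_eq_zero_of_pRegular hg.1 hg.2), Nat.card_eq_fintype_card, Fintype.card_subtype,
        Finset.sum_boole]
      simp [piFun, hg]
    · have h1 : (piFun (f ^ n)).1 g = 0 := if_neg hg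
      rw [h1, zero_mul, eq_comm]
      refine Finset.sum_eq_zero fun h _ => if_neg ?_
      rintro rfl
      exact hg ⟨pRegular_map (MulAut.conj h).toMonoidHom hg₀, (charpoly_conj h g₀).trans hg₀'⟩
  rw [Finset.sum_mul, Finset.sum_congr rfl fun g _ => key g, Finset.sum_comm]
  simp

/-- The product of `π_{f ^ n}` and `π_f` is a multiple of `π_{f ^ (n + 1)}`. The factor is the
number of matrices that conjugate a given element of type `f ^ (n + 1)` into a given block diagonal
one, times the sizes of the two conjugacy classes the blocks come from, over the orders of the
groups of blocks. -/
theorem indMul_piFun_pow {p : ℕ} [Fact p.Prime] {f : (ZMod p)[X]} (hmonic : f.Monic)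
    (hf : Irreducible f) (h0 : f.coeff 0 ≠ 0) (n : ℕ)
    (hdeg : (f ^ n).natDegree + f.natDegree = (f ^ (n + 1)).natDegree)
    (g : GLp p ((f ^ n).natDegree + f.natDegree)) :
    (indMul (piFun (f ^ n)) (piFun f)).1 g =
      (Nat.card (GL (Fin (n + 1)) (AdjoinRoot f)) : ℂ) /
        (Nat.card (GL (Fin n) (AdjoinRoot f)) * Nat.card (GL (Fin 1) (AdjoinRoot f))) *
      (piFun (f ^ (n + 1))).1 (castGL hdeg g) := by
  classical
  have hpi : ∀ (k : (ZMod p)[X]) (a : GLp p k.natDegree), (piFun k).1 a ≠ 0 →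
      PRegular p a ∧ a.val.charpoly = k := fun k a h => by
    by_contra h'
    exact h (if_neg h')
  have hN : (f ^ n).natDegree + f.natDegree = (n + 1) * f.natDegree := by
    rw [natDegree_pow, add_one_mul]
  have hblock : ∀ a : GLp p (f ^ n).natDegree × GLp p f.natDegree,
      (piFun (f ^ n)).1 a.1 * (piFun f).1 a.2 ≠ 0 → PRegular p (blockDiag p _ _ a) ∧
        (blockDiag p _ _ a).val.charpoly = f ^ (n + 1) := fun a ha => by
    obtain ⟨h1, h1'⟩ := hpi _ _ (left_ne_zero_of_mul ha)
    obtain ⟨h2, h2'⟩ := hpi _ _ (right_ne_zero_of_mul ha)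
    exact ⟨pRegular_map _ (pRegular_prodMk h1 h2), by
      rw [charpoly_blockDiag, h1', h2', pow_succ]⟩
  -- Once the two sums in the induction formula are swapped, the inner one counts a transporter.
  have key : ∀ a : GLp p (f ^ n).natDegree × GLp p f.natDegree,
      (∑ x, if x * g * x⁻¹ = blockDiag p _ _ a then
        (piFun (f ^ n)).1 a.1 * (piFun f).1 a.2 else 0) =
      (Nat.card (GL (Fin (n + 1)) (AdjoinRoot f)) : ℂ) *
        (piFun (f ^ (n + 1))).1 (castGL hdeg g) *
        ((piFun (f ^ n)).1 a.1 * (piFun f).1 a.2) := fun a => by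
    by_cases ha : (piFun (f ^ n)).1 a.1 * (piFun f).1 a.2 = 0
    · simp [ha]
    obtain ⟨hb, hb'⟩ := hblock a ha
    by_cases hg : PRegular p g ∧ g.val.charpoly = f ^ (n + 1)
    · have h1 : (piFun (f ^ (n + 1))).1 (castGL hdeg g) = 1 :=
        if_pos ⟨(pRegular_mulEquiv_iff _ _).2 hg.1, (charpoly_castGL _ _).trans hg.2⟩
      rw [h1, mul_one, ← card_transporter hf hN (aeval_eq_zero_of_pRegular hg.1 hg.2)
        (aeval_eq_zero_of_pRegular hb hb'), Nat.card_eq_fintype_card, Fintype.card_subtype,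
        ← Finset.sum_boole, Finset.sum_mul]
      simp
    · have h1 : (piFun (f ^ (n + 1))).1 (castGL hdeg g) = 0 :=
        if_neg (by rwa [pRegular_mulEquiv_iff, charpoly_castGL])
      rw [h1, mul_zero, zero_mul]
      refine Finset.sum_eq_zero fun x _ => if_neg fun h => hg ?_
      rw [← h, charpoly_conj] at hb'
      rw [← h] at hb
      exact ⟨(pRegular_mulEquiv_iff (MulAut.conj x) g).1 hb, hb'⟩
  have hs := sum_piFun_pow hmonic hf h0 n
  have hs1 := sum_piFun_pow hmonic hf h0 1
  rw [pow_one] at hs1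
  have hc : ∀ k, (Fintype.card (GLp p k) : ℂ) ≠ 0 := fun k => by
    exact_mod_cast Fintype.card_ne_zero
  change ind (blockDiag p _ _) (fun a => (piFun (f ^ n)).1 a.1 * (piFun f).1 a.2) g = _
  unfold ind
  rw [Finset.sum_comm, Finset.sum_congr rfl fun a _ => (by convert key a), ← Finset.mul_sum,
    Fintype.sum_prod_type, ← Finset.sum_mul_sum, Fintype.card_prod, Nat.cast_mul, ← hs, ← hs1]
  have hS := left_ne_zero_of_mul (hs.trans_ne (hc _))
  have hS1 := left_ne_zero_of_mul (hs1.trans_ne (hc _))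
  have hγn := natCard_GL_adjoinRoot_ne_zero hf.ne_zero n
  have hγ1 := natCard_GL_adjoinRoot_ne_zero hf.ne_zero 1
  field_simp

theorem ind_const_mul {H G : Type} [Group H] [Group G] [Fintype H] [Fintype G]
    (i : H →* G) (c : ℂ) (φ : H → ℂ) (g : G) :
    ind i (fun a => c * φ a) g = c * ind i φ g := by
  unfold ind
  simp only [Finset.mul_sum, mul_ite, mul_zero, mul_left_comm c]

theorem smul_indMul {p : ℕ} [Fact p.Prime] {n m : ℕ} (c : ℂ) (φ : RegClassFun p n)
    (ψ : RegClassFun p m) : indMul (c • φ) ψ = c • indMul φ ψ := by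
  apply Subtype.ext
  funext g
  refine Eq.trans (congrArg (fun F => ind (blockDiag p n m) F g) ?_) (ind_const_mul _ c _ g)
  funext a
  exact mul_assoc _ _ _

theorem smul_piElt_pow_mul_piElt {p : ℕ} [Fact p.Prime] {f : (ZMod p)[X]} (hmonic : f.Monic)
    (hf : Irreducible f) (h0 : f.coeff 0 ≠ 0) (n : ℕ) (c : ℂ) :
    (c • piElt (f ^ n)) * piElt f =
      (c * ((Nat.card (GL (Fin (n + 1)) (AdjoinRoot f)) : ℂ) /
        (Nat.card (GL (Fin n) (AdjoinRoot f)) * Nat.card (GL (Fin 1) (AdjoinRoot f))))) •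
      piElt (f ^ (n + 1)) := by
  have hdeg : (f ^ n).natDegree + f.natDegree = (f ^ (n + 1)).natDegree := by
    rw [natDegree_pow, natDegree_pow, add_one_mul]
  unfold piElt
  rw [← DirectSum.of_smul, ← DirectSum.of_smul, DirectSum.of_mul_of]
  refine DirectSum.of_eq_of_gradedMonoid_eq (mk_eq hdeg _ _ fun g => ?_)
  change _ = (indMul (c • piFun (f ^ n)) (piFun f)).1 g
  rw [smul_indMul]
  change _ = c * (indMul (piFun (f ^ n)) (piFun f)).1 g
  rw [indMul_piFun_pow hmonic hf h0 n hdeg, ← mul_assoc]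
  rfl

end GLInduction

theorem mainTheorem4 (p : ℕ) [Fact p.Prime] (d n : ℕ) (f : Polynomial (ZMod p))
    (hmonic : f.Monic) (hirr : Irreducible f) (hdeg : f.natDegree = d) (h0 : f.coeff 0 ≠ 0) :
    (GLInduction.piElt f) ^ n =
      ((p : ℂ) ^ (d * n.choose 2) *
        (GLInduction.psi n ((p : ℂ) ^ d) / GLInduction.psi 1 ((p : ℂ) ^ d) ^ n)) •
      GLInduction.piElt (f ^ n) := by
  subst hdeg
  have h1 : (Nat.card (GL (Fin 1) (AdjoinRoot f)) : ℂ) =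
      GLInduction.psi 1 ((p : ℂ) ^ f.natDegree) := by
    rw [GLInduction.natCard_GL_adjoinRoot hirr]
    simp
  rw [← mul_div_assoc, ← GLInduction.natCard_GL_adjoinRoot hirr, ← h1]
  induction n with
  | zero =>
    have h : GLInduction.piElt (1 : Polynomial (ZMod p)) = 1 :=
      DirectSum.of_eq_of_gradedMonoid_eq (GLInduction.mk_eq natDegree_one _ _ fun g =>
        (if_pos (GLInduction.pRegular_and_charpoly_eq_one natDegree_one g)).symm)
    have h1 : (Nat.card (GL (Fin 0) (AdjoinRoot f)) : ℂ) = 1 := by simp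
    rw [pow_zero, pow_zero, pow_zero, h, h1, div_one, one_smul]
  | succ n ih =>
    rw [pow_succ, ih, GLInduction.smul_piElt_pow_mul_piElt hmonic hirr h0]
    congr 1
    have := GLInduction.natCard_GL_adjoinRoot_ne_zero hirr.ne_zero n
    have := GLInduction.natCard_GL_adjoinRoot_ne_zero hirr.ne_zero 1
    field_simp
    ring
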